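/- Let $n\ge 1$, $0<p<\infty$, $0<q\le\infty$ and $\alpha>-1$. Let $w_\alpha(x)=|x_n|^\alpha$ if $|x_n|\le 1$ and $w_\alpha(x)=1$ if $|x_n|>1$, for $x=(x_1,\dots,x_n)\in\mathbb{R}^n$. For $j\in\mathbb{N}_0=\{0,1,2,\dots\}$ and $m\in\mathbb{Z}^n$ let $Q_{j,m}=2^{-j}m+2^{-j-1}(-1,1)^n$ be the dyadic cube with centre $2^{-j}m$ and side length $2^{-j}$. For a family $A=(A_{j,m})_{j\in\mathbb{N}_0,m\in\mathbb{Z}^n}$ of Lebesgue measurable subsets of $\mathbb{R}^n$ and a sequence $\lambda=(\lambda_{j,m})_{j\in\mathbb{N}_0,m\in\mathbb{Z}^n}$ of complex numbers put $$N_A(\lambda)=\left(\int_{\mathbb{R}^n}\Big(\sum_{j\in\mathbb{N}_0}\sum_{m\in\mathbb{Z}^n}|\lambda_{j,m}|^q\,2^{jnq/p}\,\chi_{A_{j,m}}(x)\Big)^{p/q}w_\alpha(x)\,dx\right)^{1/p}\in[0,\infty],$$ where for $q=\infty$ the expression $\big(\sum_{j,m}|\lambda_{j,m}|^q2^{jnq/p}\chi_{A_{j,m}}(x)\big)^{1/q}$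 is replaced by $\sup_{j,m}|\lambda_{j,m}|2^{jn/p}\chi_{A_{j,m}}(x)$. The quasi-norm of $\lambda$ in the sequence space $f_{p,q}(\mathbb{R}^n,w_\alpha)$ is $\|\lambda\,|\,f_{p,q}(\mathbb{R}^n,w_\alpha)\|=N_Q(\lambda)$, where $Q=(Q_{j,m})$, and $\lambda$ belongs to the space if and only if this is finite. Then for every constant $c>0$ there is a constant $C>0$, depending only on $n,p,q,\alpha$ and $c$, such that for every family $E=(E_{j,m})$ of Lebesgue measurable sets with $E_{j,m}\subseteq Q_{j,m}$ and $|Q_{j,m}|\le c\,|E_{j,m}|$ for all $j\in\mathbb{N}_0$, $m\in\mathbb{Z}^n$ (that is, $|E_{j,m}|\sim|Q_{j,m}|$ uniformly in $j$ and $m$), and for every sequence $\lambda$ of complex numbers, $$\|\lambda\,|\,f_{p,q}(\mathbb{R}^n,w_\alpha)\|\le C\,N_E(\lambda)\qquad\text{and}\qquad N_E(\lambda)\le C\,\|\lambda\,|\,f_{p,q}(\mathbb{R}^n,w_\alpha)\|.$$ -/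

import Mathlib

open MeasureTheory
open scoped ENNReal NNReal

namespace WeightedTL

noncomputable section

/-- The weight `w_α` on `ℝⁿ` (`n ≥ 1`): `|x_n|^α` if `|x_n| ≤ 1` and `1` otherwise.
Here `⊤ : Fin n` is the index of the last coordinate. (For `α < 0` the value on the Lebesgue null
set `x_n = 0` is immaterial.) -/
def weight {n : ℕ} [NeZero n] (α : ℝ) (x : Fin n → ℝ) : ℝ :=
  if |x ⊤| ≤ 1 then |x ⊤| ^ α else 1

/-- The measure `w_α(x) dx` on `ℝⁿ`, where `dx` is Lebesgue measure. The norm of `ℝⁿ` plays no role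
in this development, so plain coordinate functions `Fin n → ℝ` serve as `ℝⁿ`. -/
def weightMeasure (n : ℕ) [NeZero n] (α : ℝ) : Measure (Fin n → ℝ) :=
  (volume : Measure (Fin n → ℝ)).withDensity fun x => ENNReal.ofReal (weight α x)

/-- The open dyadic cube `Q_{j,m}` with centre `2^{-j} m` and side length `2^{-j}`. -/
def cube {n : ℕ} (j : ℕ) (m : Fin n → ℤ) : Set (Fin n → ℝ) :=
  Set.univ.pi fun r => Set.Ioo ((2 : ℝ)⁻¹ ^ j * (m r : ℝ) - (2 : ℝ)⁻¹ ^ (j + 1))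
    ((2 : ℝ)⁻¹ ^ j * (m r : ℝ) + (2 : ℝ)⁻¹ ^ (j + 1))

/-- The `ℓ_q` quasi-norm, `0 < q ≤ ∞`, of a family of nonnegative numbers indexed by
`(j, m) ∈ ℕ₀ × ℤⁿ`, with the usual supremum for `q = ∞`. -/
def ellNorm {n : ℕ} (q : ℝ≥0∞) (a : ℕ → (Fin n → ℤ) → ℝ≥0∞) : ℝ≥0∞ :=
  if q = ∞ then ⨆ j, ⨆ m, a j m
  else (∑' j, ∑' m, a j m ^ q.toReal) ^ (1 / q.toReal)

/-- `‖ ( ∑_{j,m} ( |λ_{j,m}| 2^{jn/p} χ_{A_{j,m}} )^q )^{1/q} | L_p(ℝⁿ, w_α) ‖`, an element of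
`[0, ∞]`, for a family of sets `A_{j,m}`. For finite `q` the `q`-th power of the `(j, m)` entry is
`|λ_{j,m}|^q 2^{jnq/p} χ_{A_{j,m}}`. -/
def seqNorm {n : ℕ} [NeZero n] (p : ℝ) (q : ℝ≥0∞) (α : ℝ)
    (A : ℕ → (Fin n → ℤ) → Set (Fin n → ℝ)) (lam : ℕ → (Fin n → ℤ) → ℂ) : ℝ≥0∞ :=
  (∫⁻ x, ellNorm q (fun j m =>
      (A j m).indicator (fun _ => ‖lam j m‖ₑ * (2 : ℝ≥0∞) ^ ((j : ℝ) * (n : ℝ) / p)) x) ^ p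
    ∂(weightMeasure n α)) ^ (1 / p)

/-- The quasi-norm of the sequence space `f_{p,q}(ℝⁿ, w_α)`, with value `∞` exactly for the
sequences that do not belong to the space. -/
def fNorm {n : ℕ} [NeZero n] (p : ℝ) (q : ℝ≥0∞) (α : ℝ)
    (lam : ℕ → (Fin n → ℤ) → ℂ) : ℝ≥0∞ :=
  seqNorm p q α cube lam

end

end WeightedTL

namespace WeightedTL

/-! ### Power inequalities in `ℝ≥0∞` -/

/-! Since `E_{j,m} ⊆ Q_{j,m}`, the bound of `N_E` by `N_Q` is monotonicity. The content is that
replacing every cube by a subset of proportional volume costs only a constant. No maximal function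
is used; three facts carry the proof.

Weight (`exists_weightMeasure_box_le`). On a cube with lower corner `u` and side `L` the weight has
typical size `min(|u_n| + L, 1)^α`. Integrability of `|t|^α` at `0`, i.e. `α > -1`, bounds the mass
of the cube by this size times the volume. Conversely, a thin slab around `x_n = 0` takes at most
half of the volume of `E`, and off the slab the weight is at least a constant times its typical
size. So large subsets in volume are large in weighted measure.

Geometry (`gridCube_subset_or_disjoint`). The cubes `Q_{j,m}` are not nested, but by the one-third
trick each lies in a cube of side `4 * 2⁻ʲ` taken from one of `2ⁿ` grids, and two cubes of one grid
are nested or disjoint.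

Nested families (`lintegral_rpow_sum_indicator_le`). Add the sets in order of level. The earlier sum
is constant on the new set `R_k`, so the `s`-th power of the sum grows by a constant `v` on `R_k`,
and the integral grows by `v μ(R_k) ≤ K v μ(E_k)`. For `s ≤ 1` concavity shows that the sum over the
`E_k` gains at least `v` on `E_k`. For `s > 1` a tangent bound on `v`, Young's inequality and
absorption finish.

For `q < ∞` this is used with `s = p/q`. For `q = ∞` a finite supremum is compared with sums of high
powers, i.e. with small `s`, where the nested constant does not depend on `s`. -/

theorem rpow_add_add_rpow_le {x y a s : ℝ} (hx : 0 ≤ x) (hxy : x ≤ y) (ha : 0 ≤ a) (hs : 0 ≤ s)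
    (hs1 : s ≤ 1) : (y + a) ^ s + x ^ s ≤ (x + a) ^ s + y ^ s := by
  rcases (add_nonneg ha (sub_nonneg.2 hxy)).eq_or_lt with h | h
  · have h1 : a = 0 := by linarith
    have h2 : y = x := by linarith
    subst h1 h2; simp
  · have hc := Real.concaveOn_rpow hs hs1
    have h0 : x ∈ Set.Ici (0 : ℝ) := hx
    have h1 : y + a ∈ Set.Ici (0 : ℝ) := by simp only [Set.mem_Ici]; linarith
    have hd := h.ne'
    set d := a + (y - x) with hd_def
    have hu : 0 ≤ a / d := by positivity
    have hv : 0 ≤ (y - x) / d := div_nonneg (sub_nonneg.2 hxy) h.le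
    have huv : a / d + (y - x) / d = 1 := by rw [← add_div]; exact div_self hd
    -- The points `y` and `x + a` are convex combinations of `x` and `y + a` with the two weights
    -- interchanged, so the two concavity inequalities add up to the claim.
    have e1 := hc.2 h0 h1 hu hv huv
    have e2 := hc.2 h0 h1 hv hu (by rw [add_comm]; exact huv)
    simp only [smul_eq_mul] at e1 e2
    have f1 : a / d * x + (y - x) / d * (y + a) = y := by
      field_simp; rw [hd_def]; ring
    have f2 : (y - x) / d * x + a / d * (y + a) = x + a := by
      field_simp; rw [hd_def]; ring
    rw [f1] at e1
    rw [f2] at e2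
    have : (y + a) ^ s + x ^ s = (a / d + (y - x) / d) * ((y + a) ^ s + x ^ s) := by
      rw [huv, one_mul]
    rw [this]
    linarith

theorem ennreal_rpow_add_add_rpow_le {x y a : ℝ≥0∞} {s : ℝ} (hxy : x ≤ y) (hy : y ≠ ∞) (ha : a ≠ ∞)
    (hs : 0 < s) (hs1 : s ≤ 1) : (y + a) ^ s + x ^ s ≤ (x + a) ^ s + y ^ s := by
  have hx : x ≠ ∞ := ne_top_of_le_ne_top hy hxy
  lift x to ℝ≥0 using hx
  lift y to ℝ≥0 using hy
  lift a to ℝ≥0 using ha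
  rw [← ENNReal.coe_add, ← ENNReal.coe_add, ← ENNReal.coe_rpow_of_nonneg _ hs.le,
    ← ENNReal.coe_rpow_of_nonneg _ hs.le, ← ENNReal.coe_rpow_of_nonneg _ hs.le,
    ← ENNReal.coe_rpow_of_nonneg _ hs.le, ← ENNReal.coe_add, ← ENNReal.coe_add,
    ENNReal.coe_le_coe, ← NNReal.coe_le_coe]
  push_cast
  exact rpow_add_add_rpow_le x.2 (by exact_mod_cast hxy) a.2 hs.le hs1

/-- Convexity: the graph of the power lies above its tangent at `x + a`. This is Bernoulli's
inequality at `-a / (x + a)`, rescaled. -/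
theorem ennreal_rpow_add_le_tangent {x a : ℝ≥0∞} {s : ℝ} (hx : x ≠ ∞) (ha : a ≠ ∞)
    (hs : 1 ≤ s) : (x + a) ^ s ≤ x ^ s + ENNReal.ofReal s * (a * (x + a) ^ (s - 1)) := by
  lift x to ℝ≥0 using hx
  lift a to ℝ≥0 using ha
  have hs0 : 0 ≤ s := zero_le_one.trans hs
  rw [← ENNReal.coe_add, ← ENNReal.coe_rpow_of_nonneg _ hs0, ← ENNReal.coe_rpow_of_nonneg _ hs0,
    ← ENNReal.coe_rpow_of_nonneg _ (sub_nonneg.2 hs), ENNReal.ofReal, ← ENNReal.coe_mul,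
    ← ENNReal.coe_mul, ← ENNReal.coe_add, ENNReal.coe_le_coe, ← NNReal.coe_le_coe]
  push_cast
  rw [Real.coe_toNNReal _ hs0]
  have hx : 0 ≤ (x : ℝ) := x.2
  have ha : 0 ≤ (a : ℝ) := a.2
  generalize (x : ℝ) = x at *
  generalize (a : ℝ) = a at *
  rcases (add_nonneg hx ha).eq_or_lt with h | h
  · have h1 : a = 0 := by linarith
    subst h1; simp
  · have hb := one_add_mul_self_le_rpow_one_add (s := -(a / (x + a)))
      (by rw [neg_le_neg_iff, div_le_one h]; linarith) hs
    have h1 : 1 + -(a / (x + a)) = x / (x + a) := by field_simp; ring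
    rw [h1, Real.div_rpow hx h.le, le_div_iff₀ (by positivity)] at hb
    have h2 : (x + a) ^ s = (x + a) * (x + a) ^ (s - 1) := by
      rw [Real.rpow_sub_one h.ne']; field_simp
    have h3 : (1 + s * -(a / (x + a))) * (x + a) ^ s
        = (x + a) ^ s - s * (a * (x + a) ^ (s - 1)) := by
      conv_lhs => rw [h2]
      conv_rhs => rw [h2]
      field_simp; ring
    linarith

/-- A crude Young inequality, by comparing `y` with `A * x`. The free parameter `A` makes the
coefficient of `y ^ s` small enough for absorption. -/
theorem mul_rpow_sub_one_le {x y A : ℝ≥0∞} {s : ℝ} (hA : A ≠ 0) (hA' : A ≠ ∞) (hs : 1 ≤ s) :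
    x * y ^ (s - 1) ≤ A ^ (s - 1) * x ^ s + A⁻¹ * y ^ s := by
  have key : ∀ z : ℝ≥0∞, z * z ^ (s - 1) ≤ z ^ s := by
    intro z
    rcases eq_or_ne z 0 with rfl | hz
    · simp
    rcases eq_or_ne z ∞ with rfl | hz'
    · simp [zero_lt_one.trans_le hs]
    · rw [ENNReal.rpow_sub _ _ hz hz', ENNReal.rpow_one, ENNReal.mul_div_cancel hz hz']
  rcases le_total y (A * x) with h | h
  · refine le_trans ?_ le_self_add
    calc x * y ^ (s - 1) ≤ x * (A * x) ^ (s - 1) := by gcongr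
      _ = A ^ (s - 1) * (x * x ^ (s - 1)) := by
        rw [ENNReal.mul_rpow_of_nonneg _ _ (by linarith)]; ring
      _ ≤ _ := by gcongr; exact key x
  · refine le_trans ?_ le_add_self
    have hx : x ≤ A⁻¹ * y := by
      rwa [mul_comm, ← div_eq_mul_inv, ENNReal.le_div_iff_mul_le (Or.inl hA) (Or.inl hA'), mul_comm]
    calc x * y ^ (s - 1) ≤ A⁻¹ * y * y ^ (s - 1) := by gcongr
      _ ≤ _ := by rw [mul_assoc]; gcongr; exact key y

/-! ### Nested families of sets -/

section Nested

variable {X κ : Type*} [MeasurableSpace X] {μ : Measure X}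

omit [MeasurableSpace X] in
theorem sum_indicator_ne_top (T : Finset κ) (A : κ → Set X) {a : κ → ℝ≥0∞} (ha : ∀ k, a k ≠ ∞)
    (x : X) : ∑ k ∈ T, (A k).indicator (fun _ => a k) x ≠ ∞ := by
  refine ENNReal.sum_ne_top.2 fun k _ => ?_
  by_cases h : x ∈ A k <;> simp [h, ha k]

theorem measurable_sum_indicator (T : Finset κ) {A : κ → Set X} (hA : ∀ k, MeasurableSet (A k))
    (a : κ → ℝ≥0∞) : Measurable fun x => ∑ k ∈ T, (A k).indicator (fun _ => a k) x :=
  Finset.measurable_sum T fun k _ => measurable_const.indicator (hA k)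

omit [MeasurableSpace X] in
/-- Adding a set of maximal level to a nested family raises the power of the sum by a constant
multiple of an indicator function. -/
theorem exists_rpow_sum_insert_eq [DecidableEq κ] {R : κ → Set X} {a : κ → ℝ≥0∞}
    (ha : ∀ k, a k ≠ ∞) {s : ℝ} (hs : 0 < s) {T : Finset κ} {k : κ} (hk : k ∉ T)
    (hnest : ∀ i ∈ T, R k ⊆ R i ∨ Disjoint (R k) (R i)) :
    ∃ v : ℝ≥0∞, v ≠ ∞ ∧
      (∀ x, (∑ i ∈ insert k T, (R i).indicator (fun _ => a i) x) ^ s =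
        (∑ i ∈ T, (R i).indicator (fun _ => a i) x) ^ s + (R k).indicator (fun _ => v) x) ∧
      ∀ x ∈ R k, ((∑ i ∈ T, (R i).indicator (fun _ => a i) x) + a k) ^ s =
        (∑ i ∈ T, (R i).indicator (fun _ => a i) x) ^ s + v := by
  have main : ∃ v : ℝ≥0∞, v ≠ ∞ ∧
      ∀ x ∈ R k, ((∑ i ∈ T, (R i).indicator (fun _ => a i) x) + a k) ^ s =
        (∑ i ∈ T, (R i).indicator (fun _ => a i) x) ^ s + v := by
    rcases (R k).eq_empty_or_nonempty with he | ⟨y, hy⟩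
    · exact ⟨0, by simp, by simp [he]⟩
    · set c := ∑ i ∈ T, (R i).indicator (fun _ => a i) y with hc
      have hc' : c ≠ ∞ := sum_indicator_ne_top T R ha y
      refine ⟨(c + a k) ^ s - c ^ s, ?_, fun x hx => ?_⟩
      · exact ne_top_of_le_ne_top
          (ENNReal.rpow_ne_top_of_nonneg hs.le (ENNReal.add_ne_top.2 ⟨hc', ha k⟩)) tsub_le_self
      · have : ∑ i ∈ T, (R i).indicator (fun _ => a i) x = c := by
          refine Finset.sum_congr rfl fun i hi => ?_
          rcases hnest i hi with h | h
          · simp [h hx, h hy]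
          · simp [Set.disjoint_left.1 h hx, Set.disjoint_left.1 h hy]
        rw [this, add_tsub_cancel_of_le]
        gcongr
        exact le_self_add
  obtain ⟨v, hv, h⟩ := main
  refine ⟨v, hv, fun x => ?_, h⟩
  rw [Finset.sum_insert hk]
  by_cases hx : x ∈ R k
  · simp only [Set.indicator_of_mem hx]
    rw [add_comm (a k), h x hx]
  · simp [hx]

variable {R E : κ → Set X} {a : κ → ℝ≥0∞} {K : ℝ≥0∞} {lev : κ → ℕ}

/-- On `E k` the sum over the `E i` is at most the sum over the `R i`, so by concavity adding `a k`
raises its power by at least the increment `v` of the larger sum. -/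
theorem lintegral_rpow_sum_indicator_le_of_le_one (ha : ∀ k, a k ≠ ∞)
    (hR : ∀ k, MeasurableSet (R k)) (hE : ∀ k, MeasurableSet (E k)) (hER : ∀ k, E k ⊆ R k)
    (hK : ∀ k, μ (R k) ≤ K * μ (E k)) {s : ℝ} (hs : 0 < s) (hs1 : s ≤ 1) (T : Finset κ)
    (hnest : ∀ i ∈ T, ∀ k ∈ T, lev i ≤ lev k → R k ⊆ R i ∨ Disjoint (R k) (R i)) :
    ∫⁻ x, (∑ k ∈ T, (R k).indicator (fun _ => a k) x) ^ s ∂μ ≤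
      K * ∫⁻ x, (∑ k ∈ T, (E k).indicator (fun _ => a k) x) ^ s ∂μ := by
  classical
  induction T using Finset.induction_on_max_value lev with
  | empty => simp [hs]
  | insert k T hk hmax ih =>
    have ih := ih fun i hi j hj => hnest i (Finset.mem_insert_of_mem hi) j
      (Finset.mem_insert_of_mem hj)
    obtain ⟨v, -, hv, hv'⟩ := exists_rpow_sum_insert_eq ha hs hk fun i hi =>
      hnest i (Finset.mem_insert_of_mem hi) k (Finset.mem_insert_self k T) (hmax i hi)
    simp_rw [hv]
    rw [lintegral_add_right _ (measurable_const.indicator (hR k)), lintegral_indicator (hR k),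
      setLIntegral_const]
    calc _ ≤ K * ∫⁻ x, (∑ k ∈ T, (E k).indicator (fun _ => a k) x) ^ s ∂μ
          + v * (K * μ (E k)) := by gcongr; exact hK k
      _ = K * ∫⁻ x, ((∑ k ∈ T, (E k).indicator (fun _ => a k) x) ^ s
          + (E k).indicator (fun _ => v) x) ∂μ := by
        rw [lintegral_add_right _ (measurable_const.indicator (hE k)), lintegral_indicator (hE k),
          setLIntegral_const]
        ring
      _ ≤ _ := by
        gcongr with x
        rw [Finset.sum_insert hk]
        by_cases hx : x ∈ E k
        · simp only [Set.indicator_of_mem hx]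
          have hF := sum_indicator_ne_top T R ha x
          have hle : ∑ i ∈ T, (E i).indicator (fun _ => a i) x ≤
              ∑ i ∈ T, (R i).indicator (fun _ => a i) x := by
            gcongr with i
            exact hER i
          have h := ennreal_rpow_add_add_rpow_le hle hF (ha k) hs hs1
          rw [hv' x (hER k hx), add_assoc, add_comm (a k),
            add_comm _ ((∑ i ∈ T, (R i).indicator (fun _ => a i) x) ^ s)] at *
          rw [ENNReal.add_le_add_iff_left (ENNReal.rpow_ne_top_of_nonneg hs.le hF)] at h
          rwa [add_comm]
        · simp [hx]

/-- Finiteness is what permits the absorption step for `s > 1`. -/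
theorem lintegral_rpow_sum_indicator_lt_top (ha : ∀ k, a k ≠ ∞) (hR : ∀ k, MeasurableSet (R k))
    (hfin : ∀ k, μ (R k) ≠ ∞) {s : ℝ} (hs : 0 < s) (T : Finset κ)
    (hnest : ∀ i ∈ T, ∀ k ∈ T, lev i ≤ lev k → R k ⊆ R i ∨ Disjoint (R k) (R i)) :
    ∫⁻ x, (∑ k ∈ T, (R k).indicator (fun _ => a k) x) ^ s ∂μ ≠ ∞ := by
  classical
  induction T using Finset.induction_on_max_value lev with
  | empty => simp [hs]
  | insert k T hk hmax ih =>
    have ih := ih fun i hi j hj => hnest i (Finset.mem_insert_of_mem hi) j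
      (Finset.mem_insert_of_mem hj)
    obtain ⟨v, hvt, hv, -⟩ := exists_rpow_sum_insert_eq ha hs hk fun i hi =>
      hnest i (Finset.mem_insert_of_mem hi) k (Finset.mem_insert_self k T) (hmax i hi)
    simp_rw [hv]
    rw [lintegral_add_right _ (measurable_const.indicator (hR k)), lintegral_indicator (hR k),
      setLIntegral_const]
    exact ENNReal.add_ne_top.2 ⟨ih, ENNReal.mul_ne_top hvt (hfin k)⟩

/-- The tangent bound gives `v ≤ s * a k * H ^ (s - 1)` on `E k`. The fixed majorant `H` keeps the
factor unchanged during the induction; it is later taken to be the full sum itself. -/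
theorem lintegral_rpow_sum_indicator_le_lintegral_mul (ha : ∀ k, a k ≠ ∞)
    (hR : ∀ k, MeasurableSet (R k)) (hE : ∀ k, MeasurableSet (E k)) (hER : ∀ k, E k ⊆ R k)
    (hK : ∀ k, μ (R k) ≤ K * μ (E k)) {s : ℝ} (hs : 1 ≤ s) {H : X → ℝ≥0∞} (hH : Measurable H)
    (T : Finset κ) (hTH : ∀ x, ∑ k ∈ T, (R k).indicator (fun _ => a k) x ≤ H x)
    (hnest : ∀ i ∈ T, ∀ k ∈ T, lev i ≤ lev k → R k ⊆ R i ∨ Disjoint (R k) (R i)) :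
    ∫⁻ x, (∑ k ∈ T, (R k).indicator (fun _ => a k) x) ^ s ∂μ ≤
      K * ENNReal.ofReal s *
        ∫⁻ x, (∑ k ∈ T, (E k).indicator (fun _ => a k) x) * H x ^ (s - 1) ∂μ := by
  classical
  have hs0 : 0 < s := zero_lt_one.trans_le hs
  induction T using Finset.induction_on_max_value lev with
  | empty => simp [hs0]
  | insert k T hk hmax ih =>
    have hTH' : ∀ x, (R k).indicator (fun _ => a k) x +
        ∑ k ∈ T, (R k).indicator (fun _ => a k) x ≤ H x := fun x => by
      simpa only [Finset.sum_insert hk] using hTH x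
    have ih := ih (fun x => le_add_self.trans (hTH' x)) fun i hi j hj =>
      hnest i (Finset.mem_insert_of_mem hi) j (Finset.mem_insert_of_mem hj)
    obtain ⟨v, -, hv, hv'⟩ := exists_rpow_sum_insert_eq ha hs0 hk fun i hi =>
      hnest i (Finset.mem_insert_of_mem hi) k (Finset.mem_insert_self k T) (hmax i hi)
    simp_rw [hv, Finset.sum_insert hk, add_mul]
    have hm : Measurable fun x => (E k).indicator (fun _ => a k) x * H x ^ (s - 1) :=
      (measurable_const.indicator (hE k)).mul (hH.pow_const _)
    rw [lintegral_add_right _ (measurable_const.indicator (hR k)), lintegral_indicator (hR k),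
      setLIntegral_const, lintegral_add_left hm,
      mul_add, add_comm]
    refine add_le_add ?_ ih
    calc v * μ (R k) ≤ v * (K * μ (E k)) := by gcongr; exact hK k
      _ = K * ∫⁻ x, (E k).indicator (fun _ => v) x ∂μ := by
        rw [lintegral_indicator (hE k), setLIntegral_const]; ring
      _ ≤ K * ∫⁻ x, ENNReal.ofReal s *
          ((E k).indicator (fun _ => a k) x * H x ^ (s - 1)) ∂μ := by
        gcongr with x
        by_cases hx : x ∈ E k
        · simp only [Set.indicator_of_mem hx]
          have hF := sum_indicator_ne_top T R ha x
          have h := ennreal_rpow_add_le_tangent hF (ha k) hs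
          rw [hv' x (hER k hx),
            ENNReal.add_le_add_iff_left (ENNReal.rpow_ne_top_of_nonneg hs0.le hF)] at h
          refine h.trans ?_
          have h1 := hTH' x
          rw [Set.indicator_of_mem (hER k hx), add_comm] at h1
          gcongr
        · simp [hx]
      _ = _ := by
        rw [lintegral_const_mul _ hm, mul_assoc]

/-- The constant in the comparison of a nested family with large subsets of its members. -/
noncomputable def nestedConst (K : ℝ≥0∞) (s : ℝ) : ℝ≥0∞ :=
  if s ≤ 1 then K
  else 2 * (K * ENNReal.ofReal s * (2 * (K * ENNReal.ofReal s)) ^ (s - 1))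

theorem nestedConst_ne_top (hK : K ≠ ∞) (s : ℝ) : nestedConst K s ≠ ∞ := by
  unfold nestedConst
  split_ifs with h
  · exact hK
  · have : K * ENNReal.ofReal s ≠ ∞ := ENNReal.mul_ne_top hK ENNReal.ofReal_ne_top
    refine ENNReal.mul_ne_top (by simp) (ENNReal.mul_ne_top this ?_)
    exact ENNReal.rpow_ne_top_of_nonneg (by linarith) (ENNReal.mul_ne_top (by simp) this)

theorem lintegral_rpow_sum_indicator_le (ha : ∀ k, a k ≠ ∞)
    (hR : ∀ k, MeasurableSet (R k)) (hE : ∀ k, MeasurableSet (E k)) (hER : ∀ k, E k ⊆ R k)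
    (hK0 : K ≠ 0) (hKt : K ≠ ∞) (hfin : ∀ k, μ (R k) ≠ ∞)
    (hK : ∀ k, μ (R k) ≤ K * μ (E k)) {s : ℝ} (hs : 0 < s) (T : Finset κ)
    (hnest : ∀ i ∈ T, ∀ k ∈ T, lev i ≤ lev k → R k ⊆ R i ∨ Disjoint (R k) (R i)) :
    ∫⁻ x, (∑ k ∈ T, (R k).indicator (fun _ => a k) x) ^ s ∂μ ≤
      nestedConst K s * ∫⁻ x, (∑ k ∈ T, (E k).indicator (fun _ => a k) x) ^ s ∂μ := by
  unfold nestedConst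
  split_ifs with hs1
  · exact lintegral_rpow_sum_indicator_le_of_le_one ha hR hE hER hK hs hs1 T hnest
  · have hs1 : 1 ≤ s := (not_le.1 hs1).le
    have hFm := measurable_sum_indicator T hR a
    have hGm := measurable_sum_indicator T hE a
    have h1 := lintegral_rpow_sum_indicator_le_lintegral_mul ha hR hE hER hK hs1 hFm T
      (fun x => le_rfl) hnest
    have h2 := lintegral_rpow_sum_indicator_lt_top (μ := μ) ha hR hfin hs T hnest
    have hB0 : K * ENNReal.ofReal s ≠ 0 := mul_ne_zero hK0 (by simpa using hs)
    have hBt : K * ENNReal.ofReal s ≠ ∞ := ENNReal.mul_ne_top hKt ENNReal.ofReal_ne_top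
    set B := K * ENNReal.ofReal s
    set F := fun x => ∑ k ∈ T, (R k).indicator (fun _ => a k) x
    set G := fun x => ∑ k ∈ T, (E k).indicator (fun _ => a k) x
    set I := ∫⁻ x, F x ^ s ∂μ
    set J := ∫⁻ x, G x ^ s ∂μ
    -- Young's inequality with `A = 2 * B` leaves exactly half of `I` on the right.
    have h3 : I ≤ B * (2 * B) ^ (s - 1) * J + 2⁻¹ * I := by
      calc I ≤ B * ∫⁻ x, G x * F x ^ (s - 1) ∂μ := h1
        _ ≤ B * ∫⁻ x, ((2 * B) ^ (s - 1) * G x ^ s + (2 * B)⁻¹ * F x ^ s) ∂μ := by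
          gcongr with x
          exact mul_rpow_sub_one_le (mul_ne_zero (by simp) hB0) (ENNReal.mul_ne_top (by simp) hBt)
            hs1
        _ = B * ((2 * B) ^ (s - 1) * J + (2 * B)⁻¹ * I) := by
          rw [lintegral_add_left ((hGm.pow_const s).const_mul _),
            lintegral_const_mul _ (hGm.pow_const s), lintegral_const_mul _ (hFm.pow_const s)]
        _ = _ := by
          rw [ENNReal.mul_inv (a := 2) (b := B) (by simp) (by simp), mul_add,
            show B * (2⁻¹ * B⁻¹ * I) = 2⁻¹ * (B * B⁻¹) * I by ring,
            ENNReal.mul_inv_cancel hB0 hBt, mul_one, mul_assoc B]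
    have h4 : 2⁻¹ * I + 2⁻¹ * I ≤ B * (2 * B) ^ (s - 1) * J + 2⁻¹ * I := by
      rwa [← add_mul, ENNReal.inv_two_add_inv_two, one_mul]
    rw [ENNReal.add_le_add_iff_right (ENNReal.mul_ne_top (by simp) h2),
      ENNReal.inv_mul_le_iff (by simp) (by simp)] at h4
    rwa [mul_assoc 2]

end Nested

/-! ### The weight on half-open boxes -/

/-- The half-open cube with lower corner `u` and side length `L`. -/
def box {n : ℕ} (u : Fin n → ℝ) (L : ℝ) : Set (Fin n → ℝ) :=
  Set.univ.pi fun r => Set.Ico (u r) (u r + L)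

theorem measurableSet_box {n : ℕ} (u : Fin n → ℝ) (L : ℝ) : MeasurableSet (box u L) :=
  MeasurableSet.univ_pi fun _ => measurableSet_Ico

theorem volume_box {n : ℕ} (u : Fin n → ℝ) (L : ℝ) : volume (box u L) = ENNReal.ofReal L ^ n := by
  simp [box, Real.volume_pi_Ico]

theorem setLIntegral_box_eval {n : ℕ} (i : Fin n) (u : Fin n → ℝ) (L : ℝ) {f : ℝ → ℝ≥0∞}
    (hf : Measurable f) : ∫⁻ x in box u L, f (x i) =
      ENNReal.ofReal L ^ (n - 1) * ∫⁻ t in Set.Ico (u i) (u i + L), f t := by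
  have h : ∫⁻ x in box u L, f (x i) =
      ∫⁻ t, f t ∂(Measure.map (Function.eval i) (volume.restrict (box u L))) :=
    (lintegral_map hf (measurable_pi_apply i)).symm
  rw [h, box, volume_pi, Measure.restrict_pi_pi, Measure.pi_map_eval, lintegral_smul_measure,
    smul_eq_mul]
  simp [Finset.card_erase_of_mem]

theorem weight_eq {n : ℕ} [NeZero n] (α : ℝ) (x : Fin n → ℝ) :
    weight α x = min |x ⊤| 1 ^ α := by
  unfold weight
  split_ifs with h
  · rw [min_eq_left h]
  · rw [min_eq_right (not_le.1 h).le, Real.one_rpow]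

theorem weightMeasure_box {n : ℕ} [NeZero n] (α : ℝ) (u : Fin n → ℝ) (L : ℝ) :
    weightMeasure n α (box u L) = ENNReal.ofReal L ^ (n - 1) *
      ∫⁻ t in Set.Ico (u ⊤) (u ⊤ + L), ENNReal.ofReal (min |t| 1 ^ α) := by
  rw [weightMeasure, withDensity_apply _ (measurableSet_box u L), ← setLIntegral_box_eval]
  · simp_rw [weight_eq]
  · fun_prop

theorem lintegral_Icc_abs_rpow_le {α D : ℝ} (hα : -1 < α) (hD : 0 ≤ D) :
    ∫⁻ t in Set.Icc (-D) D, ENNReal.ofReal (|t| ^ α) ≤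
      ENNReal.ofReal (2 * (D ^ (α + 1) / (α + 1))) := by
  have h1 : ∫⁻ t in Set.Icc 0 D, ENNReal.ofReal (|t| ^ α) =
      ENNReal.ofReal (D ^ (α + 1) / (α + 1)) := by
    rw [← restrict_Ioc_eq_restrict_Icc, setLIntegral_congr_fun measurableSet_Ioc
      (g := fun t => ENNReal.ofReal (t ^ α)) (fun t ht => by simp only [abs_of_pos ht.1]),
      ← ofReal_integral_eq_lintegral_ofReal]
    · rw [← intervalIntegral.integral_of_le hD, integral_rpow (Or.inl hα),
        Real.zero_rpow (by linarith), sub_zero]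
    · exact (intervalIntegral.intervalIntegrable_rpow' hα).1
    · refine (ae_restrict_iff' measurableSet_Ioc).2 (Filter.Eventually.of_forall fun t ht => ?_)
      exact Real.rpow_nonneg ht.1.le _
  have h2 : ∫⁻ t in Set.Icc (-D) 0, ENNReal.ofReal (|t| ^ α) =
      ENNReal.ofReal (D ^ (α + 1) / (α + 1)) := by
    rw [← h1, ← (Measure.measurePreserving_neg (volume : Measure ℝ)).setLIntegral_comp_preimage
      measurableSet_Icc (by fun_prop)]
    simp
  calc _ ≤ ∫⁻ t in Set.Icc (-D) 0 ∪ Set.Icc 0 D, ENNReal.ofReal (|t| ^ α) := by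
        refine lintegral_mono_set fun t ht => ?_
        rcases le_total t 0 with h | h
        · exact Or.inl ⟨ht.1, h⟩
        · exact Or.inr ⟨h, ht.2⟩
    _ ≤ _ := lintegral_union_le _ _ _
    _ = _ := by
      have : 0 ≤ D ^ (α + 1) / (α + 1) := div_nonneg (Real.rpow_nonneg hD _) (by linarith)
      rw [h1, h2, ← ENNReal.ofReal_add this this, two_mul]

/-- For `α ≥ 0` the integrand is monotone in `|t|`. For `α ≤ 0` an interval far from `0` relative to
its length has `|t|` comparable to `|u| + L`, and a near one is enlarged to an interval symmetric
about `0`. -/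
theorem exists_lintegral_Ico_min_abs_rpow_le {α : ℝ} (hα : -1 < α) :
    ∃ C : ℝ, 0 < C ∧ ∀ u L : ℝ, 0 < L →
      ∫⁻ t in Set.Ico u (u + L), ENNReal.ofReal (min |t| 1 ^ α) ≤
        ENNReal.ofReal (C * min (|u| + L) 1 ^ α * L) := by
  have hα1 : 0 < α + 1 := by linarith
  -- The summand `(1 / 2) ^ α` serves far intervals, `8 / (α + 1)` the integral `2 * D ^ (α + 1) /
  -- (α + 1)` with `D ≤ 4 * L`, and `1` the case `α ≥ 0` and the region `|t| > 1`.
  refine ⟨(1 / 2) ^ α + 8 / (α + 1) + 1, by positivity, fun u L hL => ?_⟩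
  have habs : ∀ t ∈ Set.Ico u (u + L), |t| ≤ |u| + L ∧ |u| - L ≤ |t| := by
    intro t ht
    have h1 : |t - u| ≤ L := by rw [abs_le]; constructor <;> linarith [ht.1, ht.2]
    have h2 := abs_sub_abs_le_abs_sub t u
    have h3 := abs_sub_abs_le_abs_sub u t
    rw [abs_sub_comm] at h3
    constructor <;> linarith
  have hu : 0 ≤ |u| := abs_nonneg u
  set D := |u| + L with hD
  have hD0 : 0 < D := by positivity
  have hm : 0 < min D 1 := lt_min hD0 one_pos
  have hconst : ∀ B : ℝ, B ≤ (1 / 2) ^ α + 8 / (α + 1) + 1 →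
      (∀ t ∈ Set.Ico u (u + L), min |t| 1 ^ α ≤ B * min D 1 ^ α) →
      ∫⁻ t in Set.Ico u (u + L), ENNReal.ofReal (min |t| 1 ^ α) ≤
        ENNReal.ofReal (((1 / 2) ^ α + 8 / (α + 1) + 1) * min D 1 ^ α * L) := by
    intro B hB h
    calc _ ≤ ∫⁻ t in Set.Ico u (u + L), ENNReal.ofReal (B * min D 1 ^ α) :=
          setLIntegral_mono measurable_const fun t ht => ENNReal.ofReal_le_ofReal (h t ht)
      _ = ENNReal.ofReal (B * min D 1 ^ α) * ENNReal.ofReal L := by simp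
      _ = ENNReal.ofReal (B * min D 1 ^ α * L) := (ENNReal.ofReal_mul' hL.le).symm
      _ ≤ _ := by gcongr
  have hp2 : 0 < ((1 : ℝ) / 2) ^ α := by positivity
  have hp8 : 0 < 8 / (α + 1) := by positivity
  rcases le_total 0 α with h0 | h0
  · refine hconst 1 (by linarith) fun t ht => ?_
    rw [one_mul]
    gcongr
    exact (habs t ht).1
  rcases le_total (4 * L) D with h4 | h4
  · refine hconst ((1 / 2) ^ α) (by linarith) fun t ht => ?_
    rw [← Real.mul_rpow (by norm_num) hm.le]
    refine Real.rpow_le_rpow_of_nonpos (by positivity) ?_ h0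
    refine le_min ?_ ?_
    · linarith [(habs t ht).2, min_le_left D 1]
    · linarith [min_le_right D 1]
  · have hone : 1 ≤ min D 1 ^ α := Real.one_le_rpow_of_pos_of_le_one_of_nonpos hm
      (min_le_right _ _) h0
    have hDm : D ^ α ≤ min D 1 ^ α := Real.rpow_le_rpow_of_nonpos hm (min_le_left _ _) h0
    calc _ ≤ ∫⁻ t in Set.Ico u (u + L), (ENNReal.ofReal (|t| ^ α) + 1) := by
          gcongr with t
          rw [← ENNReal.ofReal_one, ← ENNReal.ofReal_add (by positivity) zero_le_one]
          gcongr
          rcases le_total |t| 1 with h | h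
          · rw [min_eq_left h]; linarith
          · rw [min_eq_right h, Real.one_rpow]
            have : 0 ≤ |t| ^ α := by positivity
            linarith
      _ = (∫⁻ t in Set.Ico u (u + L), ENNReal.ofReal (|t| ^ α)) + ENNReal.ofReal L := by
          rw [lintegral_add_right _ measurable_const]; simp
      _ ≤ (∫⁻ t in Set.Icc (-D) D, ENNReal.ofReal (|t| ^ α)) + ENNReal.ofReal L := by
          gcongr
          intro t ht
          exact abs_le.1 (habs t ht).1
      _ ≤ ENNReal.ofReal (2 * (D ^ (α + 1) / (α + 1))) + ENNReal.ofReal L := by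
          gcongr
          exact lintegral_Icc_abs_rpow_le hα hD0.le
      _ = ENNReal.ofReal (2 * (D ^ (α + 1) / (α + 1)) + L) :=
          (ENNReal.ofReal_add (by positivity) hL.le).symm
      _ ≤ _ := by
          gcongr
          have e1 : D ^ (α + 1) ≤ 4 * L * min D 1 ^ α := by
            rw [Real.rpow_add_one hD0.ne', mul_comm]
            gcongr
          have e2 : 2 * (D ^ (α + 1) / (α + 1)) ≤ 8 / (α + 1) * min D 1 ^ α * L := by
            calc _ ≤ 2 * (4 * L * min D 1 ^ α / (α + 1)) := by gcongr
              _ = _ := by ring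
          have e3 : L ≤ min D 1 ^ α * L := le_mul_of_one_le_left hL.le hone
          have e4 : 0 ≤ (1 / 2) ^ α * min D 1 ^ α * L := by positivity
          linarith

theorem volume_box_inter_slab_le {n : ℕ} [NeZero n] (u : Fin n → ℝ) {L θ : ℝ}
    (hθ : 0 ≤ θ) : volume (box u L ∩ {x | |x ⊤| < θ * L}) ≤
      ENNReal.ofReal (2 * θ) * volume (box u L) := by
  have hS : MeasurableSet {t : ℝ | |t| < θ * L} := measurableSet_lt (by fun_prop) (by fun_prop)
  have hS' : MeasurableSet {x : Fin n → ℝ | |x ⊤| < θ * L} :=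
    measurableSet_lt (by fun_prop) (by fun_prop)
  have h := setLIntegral_box_eval ⊤ u L
    (f := {t : ℝ | |t| < θ * L}.indicator fun _ => 1) (measurable_const.indicator hS)
  have h1 : ∫⁻ x in box u L, {t : ℝ | |t| < θ * L}.indicator (fun _ => (1 : ℝ≥0∞)) (x ⊤) =
      volume (box u L ∩ {x | |x ⊤| < θ * L}) := by
    calc _ = ∫⁻ x in box u L,
          {x : Fin n → ℝ | |x ⊤| < θ * L}.indicator (fun _ => (1 : ℝ≥0∞)) x := rfl
      _ = _ := by
        rw [lintegral_indicator hS', setLIntegral_one, Measure.restrict_apply hS', Set.inter_comm]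
  rw [← h1, h, lintegral_indicator hS, setLIntegral_one, volume_box]
  calc _ ≤ ENNReal.ofReal L ^ (n - 1) * volume (Set.Ioo (-(θ * L)) (θ * L)) := by
        gcongr ENNReal.ofReal L ^ (n - 1) * ?_
        refine (Measure.restrict_apply_le _ _).trans (measure_mono fun t ht => ?_)
        exact abs_lt.1 ht
    _ = ENNReal.ofReal L ^ (n - 1) * (ENNReal.ofReal (2 * θ) * ENNReal.ofReal L) := by
        rw [Real.volume_Ioo, ← ENNReal.ofReal_mul (by positivity)]
        congr 2; ring
    _ = _ := by
        rw [← pow_sub_one_mul (NeZero.ne n) (ENNReal.ofReal L)]; ring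

theorem exists_mul_volume_le_weightMeasure (n : ℕ) [NeZero n] (α : ℝ) (k : ℝ≥0) :
    ∃ c : ℝ, 0 < c ∧ ∀ (u : Fin n → ℝ) (L : ℝ) (E : Set (Fin n → ℝ)), 0 < L → E ⊆ box u L →
      volume (box u L) ≤ k * volume E →
      ENNReal.ofReal (c * min (|u ⊤| + L) 1 ^ α) * volume E ≤ 2 * weightMeasure n α E := by
  -- The slab `|x_n| < θ * L` fills at most the fraction `2 * θ` of the box, hence has at most `2 *
  -- θ * k ≤ 1 / 2` of the volume of `E`.
  set θ : ℝ := 1 / (4 * (k + 1)) with hθ_def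
  have hk : (0 : ℝ) ≤ k := k.2
  have hθ : 0 < θ := by positivity
  have hθ1 : θ ≤ 1 := by rw [hθ_def, div_le_one (by positivity)]; linarith
  have hθk : 2 * θ * k ≤ 1 / 2 := by
    rw [hθ_def]
    field_simp
    linarith
  refine ⟨min ((θ / 4) ^ α) 1, lt_min (by positivity) one_pos, fun u L E hL hE hvol => ?_⟩
  set S := {x : Fin n → ℝ | |x ⊤| < θ * L} with hS_def
  have hS : MeasurableSet S := measurableSet_lt (by fun_prop) (by fun_prop)
  have hu : 0 ≤ |u ⊤| := abs_nonneg _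
  set D := |u ⊤| + L with hD
  have hD0 : 0 < D := by positivity
  have hm : 0 < min D 1 := lt_min hD0 one_pos
  have hEt : volume E ≠ ∞ := by
    refine ne_top_of_le_ne_top ?_ (measure_mono hE)
    rw [volume_box]
    finiteness
  have hES : volume (E ∩ S) ≤ 2⁻¹ * volume E := by
    calc volume (E ∩ S) ≤ volume (box u L ∩ S) := by gcongr
      _ ≤ ENNReal.ofReal (2 * θ) * volume (box u L) := volume_box_inter_slab_le u hθ.le
      _ ≤ ENNReal.ofReal (2 * θ) * (k * volume E) := by gcongr
      _ = ENNReal.ofReal (2 * θ * k) * volume E := by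
        rw [← mul_assoc, ENNReal.ofReal_mul (q := (k : ℝ)) (by positivity),
          ENNReal.ofReal_coe_nnreal]
      _ ≤ ENNReal.ofReal (1 / 2) * volume E := by gcongr
      _ = _ := by
        rw [one_div, ENNReal.ofReal_inv_of_pos (by norm_num)]; norm_num
  have hEd : volume E ≤ 2 * volume (E \ S) := by
    have h := measure_inter_add_sdiff (μ := volume) E hS
    have h1 : 2⁻¹ * volume E + 2⁻¹ * volume E ≤ 2⁻¹ * volume E + volume (E \ S) := by
      rw [← add_mul, ENNReal.inv_two_add_inv_two, one_mul]
      nth_rewrite 1 [← h]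
      gcongr
    rwa [ENNReal.add_le_add_iff_left (ENNReal.mul_ne_top (by simp) hEt),
      ENNReal.inv_mul_le_iff (by simp) (by simp)] at h1
  have hw : ∀ x ∈ E \ S, min ((θ / 4) ^ α) 1 * min D 1 ^ α ≤ weight α x := by
    intro x hx
    have hxb := hE hx.1 ⊤ (Set.mem_univ _)
    simp only [Set.mem_Ico] at hxb
    have hxS : θ * L ≤ |x ⊤| := not_lt.1 hx.2
    have h1 : |x ⊤ - u ⊤| ≤ L := by rw [abs_le]; constructor <;> linarith [hxb.1, hxb.2]
    have h2 := abs_sub_abs_le_abs_sub (x ⊤) (u ⊤)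
    have h3 := abs_sub_abs_le_abs_sub (u ⊤) (x ⊤)
    rw [abs_sub_comm] at h3
    -- Far from the hyperplane this follows from `|x_n| ≥ |u_n| - L`; near it, from avoiding the
    -- slab.
    have hlow : θ / 4 * D ≤ |x ⊤| := by
      rcases le_total (4 * L) D with h4 | h4
      · have : θ * D ≤ 1 * D := by gcongr
        linarith
      · have : θ * D ≤ θ * (4 * L) := by gcongr
        linarith
    have hlow' : θ / 4 * min D 1 ≤ min |x ⊤| 1 := by
      refine le_min ?_ ?_
      · refine le_trans ?_ hlow
        gcongr
        exact min_le_left _ _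
      · calc θ / 4 * min D 1 ≤ 1 * 1 := by
              gcongr
              · linarith
              · exact min_le_right _ _
          _ = 1 := one_mul 1
    have hx0 : 0 < min |x ⊤| 1 := lt_of_lt_of_le (by positivity) hlow'
    rw [weight_eq]
    rcases le_total 0 α with h0 | h0
    · calc _ ≤ (θ / 4) ^ α * min D 1 ^ α := by gcongr; exact min_le_left _ _
        _ = (θ / 4 * min D 1) ^ α := (Real.mul_rpow (by positivity) hm.le).symm
        _ ≤ _ := by gcongr
    · calc _ ≤ 1 * min D 1 ^ α := by gcongr; exact min_le_right _ _
        _ = min D 1 ^ α := one_mul _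
        _ ≤ _ := Real.rpow_le_rpow_of_nonpos hx0 (by gcongr; linarith) h0
  have hmeas : Measurable fun x : Fin n → ℝ => ENNReal.ofReal (weight α x) := by
    simp_rw [weight_eq]
    fun_prop
  calc _ ≤ ENNReal.ofReal (min ((θ / 4) ^ α) 1 * min D 1 ^ α) * (2 * volume (E \ S)) := by
        gcongr
    _ = 2 * ∫⁻ _ in E \ S, ENNReal.ofReal (min ((θ / 4) ^ α) 1 * min D 1 ^ α) := by
        rw [setLIntegral_const]; ring
    _ ≤ 2 * ∫⁻ x in E \ S, ENNReal.ofReal (weight α x) := by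
        gcongr 2 * ?_
        exact setLIntegral_mono hmeas fun x hx => ENNReal.ofReal_le_ofReal (hw x hx)
    _ ≤ 2 * weightMeasure n α (E \ S) := by gcongr; exact withDensity_apply_le _ _
    _ ≤ _ := by gcongr; exact Set.sdiff_subset

/-- The weighted measure of a cube is controlled by that of its subsets of comparable volume. -/
theorem exists_weightMeasure_box_le (n : ℕ) [NeZero n] {α : ℝ} (hα : -1 < α) {k : ℝ≥0}
    (hk : 0 < k) : ∃ K : ℝ≥0∞, K ≠ 0 ∧ K ≠ ∞ ∧
      ∀ (u : Fin n → ℝ) (L : ℝ), 0 < L → weightMeasure n α (box u L) ≠ ∞ ∧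
        ∀ E ⊆ box u L, volume (box u L) ≤ k * volume E →
          weightMeasure n α (box u L) ≤ K * weightMeasure n α E := by
  obtain ⟨C, hC, hup⟩ := exists_lintegral_Ico_min_abs_rpow_le hα
  obtain ⟨c, hc, hlow⟩ := exists_mul_volume_le_weightMeasure n α k
  refine ⟨ENNReal.ofReal (C / c) * (k * 2), ?_, by finiteness, fun u L hL => ?_⟩
  · exact mul_ne_zero (by simpa using div_pos hC hc) (mul_ne_zero (by simpa using hk.ne') (by simp))
  have hbox : weightMeasure n α (box u L) ≤
      ENNReal.ofReal (C * min (|u ⊤| + L) 1 ^ α) * volume (box u L) := by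
    rw [weightMeasure_box, volume_box]
    calc _ ≤ ENNReal.ofReal L ^ (n - 1) *
          ENNReal.ofReal (C * min (|u ⊤| + L) 1 ^ α * L) := by gcongr; exact hup _ _ hL
      _ = _ := by
        rw [ENNReal.ofReal_mul' hL.le, ← pow_sub_one_mul (NeZero.ne n) (ENNReal.ofReal L)]; ring
  refine ⟨ne_top_of_le_ne_top ?_ hbox, fun E hE hvol => ?_⟩
  · rw [volume_box]
    finiteness
  · set m := min (|u ⊤| + L) 1 ^ α
    have hsplit : ENNReal.ofReal (C * m) = ENNReal.ofReal (C / c) * ENNReal.ofReal (c * m) := by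
      rw [← ENNReal.ofReal_mul (by positivity)]
      congr 1
      field_simp
    calc _ ≤ ENNReal.ofReal (C * m) * (k * volume E) := by
          refine hbox.trans ?_
          gcongr
      _ = ENNReal.ofReal (C / c) * (k * (ENNReal.ofReal (c * m) * volume E)) := by
          rw [hsplit]; ring
      _ ≤ ENNReal.ofReal (C / c) * (k * (2 * weightMeasure n α E)) := by
          gcongr ENNReal.ofReal (C / c) * (k * ?_)
          exact hlow u L E hL hE hvol
      _ = _ := by ring

/-! ### Shifted dyadic grids -/

/-- The shift of the `j`-th level of the two dyadic grids of the one-third trick, in units of the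
side length. -/
noncomputable def gridShift (b : Bool) (j : ℕ) : ℝ := if b then (-1) ^ j / 3 else 0

/-- The index of the interval of length `4 * 2⁻ʲ` of the grid `b` which contains `t`. -/
noncomputable def gridIndex (b : Bool) (j : ℕ) (t : ℝ) : ℤ := ⌊2 ^ j * t / 4 - gridShift b j⌋

/-- The alternating sign makes `gridShift true j - gridShift true (j + 1) / 2 = (-1) ^ j / 2`, a
half-integer, so the fine index determines the coarse one. This is the nestedness of the grid. -/
theorem gridIndex_eq_of_succ (b : Bool) (j : ℕ) (t : ℝ) :
    gridIndex b j t = (gridIndex b (j + 1) t - (if b then (-1) ^ j else 0)) / 2 := by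
  unfold gridIndex
  rw [← Int.floor_sub_intCast, show (2 : ℤ) = ((2 : ℕ) : ℤ) by rfl, ← Int.floor_div_natCast]
  congr 1
  cases b <;> simp [gridShift, pow_succ] <;> ring

theorem gridIndex_eq_of_le {b : Bool} {i j : ℕ} (hij : i ≤ j) {t t' : ℝ}
    (h : gridIndex b j t = gridIndex b j t') : gridIndex b i t = gridIndex b i t' := by
  induction j, hij using Nat.le_induction with
  | base => exact h
  | succ j _ ih => exact ih (by rw [gridIndex_eq_of_succ, h, ← gridIndex_eq_of_succ])

/-- The grid in which the interval with centre `2⁻ʲ m` and length `2⁻ʲ` is well inside a cell. -/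
def gridClass (m : ℤ) : Bool := decide (4 ∣ m)

/-- In units of `2⁻ʲ` the interval is `(m - 1/2, m + 1/2)`. It meets the unshifted endpoints `4ℤ`
only if `4 ∣ m`, and then it misses the shifted endpoints, which lie at distance at least `4/3` from
`m`. -/
theorem gridIndex_eq_of_mem {j : ℕ} {m : ℤ} {t : ℝ}
    (ht : t ∈ Set.Ioo ((2 : ℝ)⁻¹ ^ j * (m : ℝ) - (2 : ℝ)⁻¹ ^ (j + 1))
      ((2 : ℝ)⁻¹ ^ j * (m : ℝ) + (2 : ℝ)⁻¹ ^ (j + 1))) :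
    gridIndex (gridClass m) j t = ⌊(m : ℝ) / 4 - gridShift (gridClass m) j⌋ := by
  have hpow : (2 : ℝ) ^ j * (2 : ℝ)⁻¹ ^ j = 1 := by
    rw [← mul_pow]; norm_num
  have h2 : (0 : ℝ) < 2 ^ j := by positivity
  have hlo : (m : ℝ) - 1 / 2 < 2 ^ j * t := by
    calc (m : ℝ) - 1 / 2 = (2 ^ j * (2 : ℝ)⁻¹ ^ j) * (m - 1 / 2) := by rw [hpow, one_mul]
      _ = 2 ^ j * ((2 : ℝ)⁻¹ ^ j * (m : ℝ) - (2 : ℝ)⁻¹ ^ (j + 1)) := by rw [pow_succ]; ring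
      _ < _ := by gcongr; exact ht.1
  have hhi : 2 ^ j * t < (m : ℝ) + 1 / 2 := by
    calc _ < 2 ^ j * ((2 : ℝ)⁻¹ ^ j * (m : ℝ) + (2 : ℝ)⁻¹ ^ (j + 1)) := by gcongr; exact ht.2
      _ = (2 ^ j * (2 : ℝ)⁻¹ ^ j) * (m + 1 / 2) := by rw [pow_succ]; ring
      _ = _ := by rw [hpow, one_mul]
  unfold gridIndex
  rw [Int.floor_eq_iff]
  generalize (2 : ℝ) ^ j * t = w at *
  by_cases hm : (4 : ℤ) ∣ m
  · obtain ⟨q, rfl⟩ := hm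
    have hc : gridClass (4 * q) = true := by simp [gridClass]
    rw [hc]
    push_cast at *
    have hs : gridShift true j = 1 / 3 ∨ gridShift true j = -(1 / 3) := by
      rcases neg_one_pow_eq_or ℝ j with h | h <;> simp [gridShift, h]
      right; norm_num
    rcases hs with h | h <;> rw [h]
    · have : ⌊4 * (q : ℝ) / 4 - 1 / 3⌋ = q - 1 := by
        rw [Int.floor_eq_iff]; push_cast; constructor <;> linarith
      rw [this]; push_cast; constructor <;> linarith
    · have : ⌊4 * (q : ℝ) / 4 - -(1 / 3)⌋ = q := by
        rw [Int.floor_eq_iff]; constructor <;> linarith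
      rw [this]; constructor <;> linarith
  · have hc : gridClass m = false := by simpa [gridClass] using hm
    rw [hc]
    have hs : gridShift false j = 0 := by simp [gridShift]
    rw [hs, sub_zero, sub_zero]
    have h1 : 4 * (m / 4) + 1 ≤ m := by omega
    have h3 : m ≤ 4 * (m / 4) + 3 := by omega
    have h1' : 4 * ((m / 4 : ℤ) : ℝ) + 1 ≤ m := by exact_mod_cast h1
    have h3' : (m : ℝ) ≤ 4 * ((m / 4 : ℤ) : ℝ) + 3 := by exact_mod_cast h3
    have : ⌊(m : ℝ) / 4⌋ = m / 4 := by
      rw [Int.floor_eq_iff]; constructor <;> linarith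
    rw [this]; constructor <;> linarith

/-- The lower corner of the grid cube associated with the dyadic cube `Q_{j,m}`. -/
noncomputable def gridCorner {n : ℕ} (j : ℕ) (m : Fin n → ℤ) (r : Fin n) : ℝ :=
  4 * (2 : ℝ)⁻¹ ^ j * (⌊(m r : ℝ) / 4 - gridShift (gridClass (m r)) j⌋ +
    gridShift (gridClass (m r)) j)

/-- The grid cube of side length `4 * 2⁻ʲ` associated with the dyadic cube `Q_{j,m}`. -/
noncomputable def gridCube {n : ℕ} (j : ℕ) (m : Fin n → ℤ) : Set (Fin n → ℝ) :=
  box (gridCorner j m) (4 * (2 : ℝ)⁻¹ ^ j)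

theorem mem_gridCube {n : ℕ} {j : ℕ} {m : Fin n → ℤ} {x : Fin n → ℝ} :
    x ∈ gridCube j m ↔ ∀ r, gridIndex (gridClass (m r)) j (x r) =
      ⌊(m r : ℝ) / 4 - gridShift (gridClass (m r)) j⌋ := by
  simp only [gridCube, box, Set.mem_univ_pi]
  refine forall_congr' fun r => ?_
  rw [gridIndex, Int.floor_eq_iff, gridCorner, Set.mem_Ico]
  generalize ⌊(m r : ℝ) / 4 - gridShift (gridClass (m r)) j⌋ = z
  generalize gridShift (gridClass (m r)) j = σ
  have h2 : (0 : ℝ) < 2 ^ j := by positivity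
  rw [inv_pow]
  have e1 : 4 * ((2 : ℝ) ^ j)⁻¹ * (z + σ) = (4 * (z + σ)) / 2 ^ j := by ring
  have e2 : 4 * ((2 : ℝ) ^ j)⁻¹ * (z + σ) + 4 * ((2 : ℝ) ^ j)⁻¹ = (4 * (z + σ) + 4) / 2 ^ j := by
    ring
  rw [e2, e1, div_le_iff₀ h2, lt_div_iff₀ h2, mul_comm (x r)]
  constructor <;> rintro ⟨h, h'⟩ <;> constructor <;> linarith

theorem measurableSet_gridCube {n : ℕ} (j : ℕ) (m : Fin n → ℤ) : MeasurableSet (gridCube j m) :=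
  measurableSet_box _ _

theorem measurableSet_cube {n : ℕ} (j : ℕ) (m : Fin n → ℤ) : MeasurableSet (cube j m) :=
  MeasurableSet.univ_pi fun _ => measurableSet_Ioo

theorem cube_subset_gridCube {n : ℕ} (j : ℕ) (m : Fin n → ℤ) : cube j m ⊆ gridCube j m :=
  fun _ hx => mem_gridCube.2 fun r => gridIndex_eq_of_mem (hx r (Set.mem_univ r))

theorem gridCube_subset_or_disjoint {n : ℕ} {i j : ℕ} (hij : i ≤ j) {m m' : Fin n → ℤ}
    (h : ∀ r, gridClass (m' r) = gridClass (m r)) :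
    gridCube j m ⊆ gridCube i m' ∨ Disjoint (gridCube j m) (gridCube i m') := by
  by_cases hd : Disjoint (gridCube j m) (gridCube i m')
  · exact Or.inr hd
  · obtain ⟨y, hy, hy'⟩ := Set.not_disjoint_iff.1 hd
    refine Or.inl fun x hx => ?_
    rw [mem_gridCube] at *
    intro r
    rw [← hy' r, h r]
    exact gridIndex_eq_of_le hij ((hx r).trans (hy r).symm)

theorem volume_gridCube {n : ℕ} (j : ℕ) (m : Fin n → ℤ) :
    volume (gridCube j m) = 4 ^ n * volume (cube j m) := by
  have h : ∀ r : Fin n, (2 : ℝ)⁻¹ ^ j * (m r : ℝ) + (2 : ℝ)⁻¹ ^ (j + 1) -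
      ((2 : ℝ)⁻¹ ^ j * (m r : ℝ) - (2 : ℝ)⁻¹ ^ (j + 1)) = (2 : ℝ)⁻¹ ^ j := fun r => by
    rw [pow_succ]; ring
  rw [gridCube, volume_box, cube, Real.volume_pi_Ioo]
  simp only [h, Finset.prod_const, Finset.card_univ, Fintype.card_fin]
  rw [ENNReal.ofReal_mul (by norm_num), mul_pow]
  norm_num

/-! ### Comparison for finite families -/

theorem rpow_sum_le {ι : Type*} [Fintype ι] (f : ι → ℝ≥0∞) {s : ℝ} (hs : 0 < s) :
    (∑ i, f i) ^ s ≤ (Fintype.card ι : ℝ≥0∞) ^ s * ∑ i, f i ^ s := by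
  have h : ∀ i, f i ≤ (∑ i, f i ^ s) ^ s⁻¹ := fun i => by
    rw [ENNReal.le_rpow_inv_iff hs]
    exact Finset.single_le_sum (f := fun i => f i ^ s) (fun _ _ => zero_le) (Finset.mem_univ i)
  calc (∑ i, f i) ^ s ≤ (∑ _i : ι, (∑ i, f i ^ s) ^ s⁻¹) ^ s := by
        gcongr with i
        exact h i
    _ = _ := by
        rw [Finset.sum_const, nsmul_eq_mul, ENNReal.mul_rpow_of_nonneg _ _ hs.le,
          ENNReal.rpow_inv_rpow hs.ne', Finset.card_univ]

/-- The indices split into `2ⁿ` classes by grid, and the nested estimate applies in each class with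
the large grid cubes as `R` and the given sets as `E`. -/
theorem lintegral_rpow_sum_cube_le {n : ℕ} {μ : Measure (Fin n → ℝ)} {K : ℝ≥0∞} (hK0 : K ≠ 0)
    (hKt : K ≠ ∞) {E : ℕ → (Fin n → ℤ) → Set (Fin n → ℝ)} (hE : ∀ j m, MeasurableSet (E j m))
    (hEQ : ∀ j m, E j m ⊆ cube j m) (hfin : ∀ j (m : Fin n → ℤ), μ (gridCube j m) ≠ ∞)
    (hK : ∀ j m, μ (gridCube j m) ≤ K * μ (E j m)) {s : ℝ} (hs : 0 < s)
    {a : ℕ × (Fin n → ℤ) → ℝ≥0∞} (ha : ∀ k, a k ≠ ∞) (T : Finset (ℕ × (Fin n → ℤ))) :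
    ∫⁻ x, (∑ k ∈ T, (cube k.1 k.2).indicator (fun _ => a k) x) ^ s ∂μ ≤
      (2 ^ n : ℝ≥0∞) ^ s * (2 ^ n * nestedConst K s) *
        ∫⁻ x, (∑ k ∈ T, (E k.1 k.2).indicator (fun _ => a k) x) ^ s ∂μ := by
  set cls : ℕ × (Fin n → ℤ) → (Fin n → Bool) := fun k r => gridClass (k.2 r) with hcls
  have hcard : (Fintype.card (Fin n → Bool) : ℝ≥0∞) = 2 ^ n := by simp
  have hR : ∀ k : ℕ × (Fin n → ℤ), MeasurableSet (gridCube k.1 k.2) :=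
    fun k => measurableSet_gridCube _ _
  have hclass : ∀ t : Fin n → Bool,
      ∫⁻ x, (∑ k ∈ T with cls k = t, (gridCube k.1 k.2).indicator (fun _ => a k) x) ^ s ∂μ ≤
        nestedConst K s * ∫⁻ x, (∑ k ∈ T, (E k.1 k.2).indicator (fun _ => a k) x) ^ s ∂μ := by
    intro t
    refine (lintegral_rpow_sum_indicator_le (lev := Prod.fst) (E := fun k => E k.1 k.2) (K := K)
      ha hR (fun k => hE _ _) (fun k => (hEQ _ _).trans (cube_subset_gridCube _ _)) hK0 hKt
      (fun k => hfin _ _) (fun k => hK _ _) hs _ ?_).trans ?_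
    · intro i hi k hk hik
      refine gridCube_subset_or_disjoint hik fun r => ?_
      have h1 := (Finset.mem_filter.1 hi).2
      have h2 := (Finset.mem_filter.1 hk).2
      exact congrFun (h1.trans h2.symm) r
    · gcongr with x
      exact Finset.filter_subset _ _
  calc _ ≤ ∫⁻ x, (∑ t, ∑ k ∈ T with cls k = t,
        (gridCube k.1 k.2).indicator (fun _ => a k) x) ^ s ∂μ := by
        gcongr with x
        rw [Finset.sum_fiberwise]
        gcongr with k
        exact cube_subset_gridCube _ _
    _ ≤ ∫⁻ x, (2 ^ n : ℝ≥0∞) ^ s * ∑ t, (∑ k ∈ T with cls k = t,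
        (gridCube k.1 k.2).indicator (fun _ => a k) x) ^ s ∂μ := by
        gcongr with x
        rw [← hcard]
        exact rpow_sum_le _ hs
    _ = (2 ^ n : ℝ≥0∞) ^ s * ∑ t, ∫⁻ x, (∑ k ∈ T with cls k = t,
        (gridCube k.1 k.2).indicator (fun _ => a k) x) ^ s ∂μ := by
        have hm := fun t : Fin n → Bool =>
          (measurable_sum_indicator (T.filter fun k => cls k = t) hR a).pow_const s
        rw [lintegral_const_mul _ (Finset.measurable_sum _ fun t _ => hm t),
          lintegral_finsetSum _ fun t _ => hm t]
    _ ≤ (2 ^ n : ℝ≥0∞) ^ s * ∑ _t : Fin n → Bool, nestedConst K s *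
        ∫⁻ x, (∑ k ∈ T, (E k.1 k.2).indicator (fun _ => a k) x) ^ s ∂μ := by
        gcongr with t
        exact hclass t
    _ = _ := by
        rw [Finset.sum_const, nsmul_eq_mul, Finset.card_univ, hcard]
        ring

/-- The supremum to the power `p` is at most `(∑ b ^ (p / s)) ^ s`, which exceeds it by at most the
factor `T.card ^ s`. The sum estimate for `s ≤ 1` has a constant bounded uniformly in `s`, so `s`
may depend on `T`. -/
theorem lintegral_rpow_sup_cube_le {n : ℕ} {μ : Measure (Fin n → ℝ)} {K : ℝ≥0∞} (hK0 : K ≠ 0)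
    (hKt : K ≠ ∞) {E : ℕ → (Fin n → ℤ) → Set (Fin n → ℝ)} (hE : ∀ j m, MeasurableSet (E j m))
    (hEQ : ∀ j m, E j m ⊆ cube j m) (hfin : ∀ j (m : Fin n → ℤ), μ (gridCube j m) ≠ ∞)
    (hK : ∀ j m, μ (gridCube j m) ≤ K * μ (E j m)) {p : ℝ} (hp : 0 < p)
    {a : ℕ × (Fin n → ℤ) → ℝ≥0∞} (ha : ∀ k, a k ≠ ∞) (T : Finset (ℕ × (Fin n → ℤ))) :
    ∫⁻ x, (T.sup fun k => (cube k.1 k.2).indicator (fun _ => a k) x) ^ p ∂μ ≤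
      2 ^ n * (2 ^ n * K) * 2 *
        ∫⁻ x, (⨆ k : ℕ × (Fin n → ℤ), (E k.1 k.2).indicator (fun _ => a k) x) ^ p ∂μ := by
  -- This choice gives `T.card ^ s ≤ 2`, since `T.card ≤ 2 ^ (T.card + 1)`.
  set s : ℝ := ((T.card : ℝ) + 1)⁻¹ with hs_def
  have hs : 0 < s := by positivity
  have hs1 : s ≤ 1 := inv_le_one_of_one_le₀ (by linarith [(T.card.cast_nonneg : (0 : ℝ) ≤ _)])
  have hps : 0 < p / s := by positivity
  have hind : ∀ (A : Set (Fin n → ℝ)) (b : ℝ≥0∞) x,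
      A.indicator (fun _ => b ^ (p / s)) x = (A.indicator (fun _ => b) x) ^ (p / s) := by
    intro A b x
    by_cases hx : x ∈ A <;> simp [hx, hps]
  have hcancel : p / s * s = p := by field_simp
  have h2 : (T.card : ℝ≥0∞) ^ s ≤ 2 := by
    rw [hs_def, ENNReal.rpow_inv_le_iff (by positivity)]
    calc (T.card : ℝ≥0∞) ≤ ((2 ^ (T.card + 1) : ℕ) : ℝ≥0∞) := by
          exact_mod_cast (Nat.lt_two_pow_self.le.trans (Nat.pow_le_pow_right two_pos (by omega)))
      _ = 2 ^ ((T.card : ℝ) + 1) := by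
          rw [← Nat.cast_succ, ENNReal.rpow_natCast]; norm_cast
  calc _ ≤ ∫⁻ x, (∑ k ∈ T, (cube k.1 k.2).indicator (fun _ => a k ^ (p / s)) x) ^ s ∂μ := by
        gcongr with x
        nth_rewrite 1 [← hcancel]
        rw [ENNReal.rpow_mul]
        gcongr
        rw [ENNReal.le_rpow_inv_iff hps |>.symm]
        refine Finset.sup_le fun k hk => ?_
        rw [ENNReal.le_rpow_inv_iff hps, ← hind]
        exact Finset.single_le_sum
          (f := fun k : ℕ × (Fin n → ℤ) => (cube k.1 k.2).indicator (fun _ => a k ^ (p / s)) x)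
          (fun _ _ => zero_le) hk
    _ ≤ (2 ^ n : ℝ≥0∞) ^ s * (2 ^ n * nestedConst K s) *
        ∫⁻ x, (∑ k ∈ T, (E k.1 k.2).indicator (fun _ => a k ^ (p / s)) x) ^ s ∂μ :=
        lintegral_rpow_sum_cube_le hK0 hKt hE hEQ hfin hK hs
          (fun k => ENNReal.rpow_ne_top_of_nonneg hps.le (ha k)) T
    _ ≤ 2 ^ n * (2 ^ n * K) * ∫⁻ x, 2 *
        (⨆ k : ℕ × (Fin n → ℤ), (E k.1 k.2).indicator (fun _ => a k) x) ^ p ∂μ := by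
        have h1 : nestedConst K s = K := if_pos hs1
        rw [h1]
        gcongr with x
        · calc (2 ^ n : ℝ≥0∞) ^ s ≤ (2 ^ n : ℝ≥0∞) ^ (1 : ℝ) :=
              ENNReal.rpow_le_rpow_of_exponent_le (one_le_pow₀ (by norm_num)) hs1
            _ = 2 ^ n := ENNReal.rpow_one _
        · calc _ ≤ (∑ _k ∈ T, (⨆ k : ℕ × (Fin n → ℤ),
                (E k.1 k.2).indicator (fun _ => a k) x) ^ (p / s)) ^ s := by
                gcongr with k
                rw [hind]
                gcongr
                exact le_iSup (fun k : ℕ × (Fin n → ℤ) => (E k.1 k.2).indicator (fun _ => a k) x) k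
            _ = (T.card : ℝ≥0∞) ^ s * (⨆ k : ℕ × (Fin n → ℤ),
                (E k.1 k.2).indicator (fun _ => a k) x) ^ p := by
                rw [Finset.sum_const, nsmul_eq_mul, ENNReal.mul_rpow_of_nonneg _ _ hs.le,
                  ← ENNReal.rpow_mul, hcancel]
            _ ≤ _ := by gcongr
    _ = _ := by
        rw [lintegral_const_mul' _ _ (by simp)]; ring

/-! ### Comparison for infinite families -/

/-- Fatou's lemma along finite subsets, used for partial sums and for finite suprema alike. -/
theorem lintegral_rpow_le_of_tendsto {X κ : Type*} [MeasurableSpace X] [Countable κ]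
    {μ : Measure X} {F : X → ℝ≥0∞} {f : Finset κ → X → ℝ≥0∞} (hf : ∀ T, Measurable (f T))
    (hF : ∀ x, Filter.Tendsto (fun T => f T x) Filter.atTop (nhds (F x))) (s : ℝ) {B : ℝ≥0∞}
    (hB : ∀ T, ∫⁻ x, f T x ^ s ∂μ ≤ B) : ∫⁻ x, F x ^ s ∂μ ≤ B := by
  have h : ∀ x, Filter.liminf (fun T => f T x ^ s) Filter.atTop = F x ^ s := fun x =>
    ((ENNReal.continuous_rpow_const.tendsto _).comp (hF x)).liminf_eq
  calc _ = ∫⁻ x, Filter.liminf (fun T => f T x ^ s) Filter.atTop ∂μ := by simp_rw [h]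
    _ ≤ Filter.liminf (fun T => ∫⁻ x, f T x ^ s ∂μ) Filter.atTop :=
        lintegral_liminf_le fun T => (hf T).pow_const s
    _ ≤ _ := Filter.liminf_le_of_le (by isBoundedDefault) fun b hb => by
        obtain ⟨T, hT⟩ := hb.exists
        exact hT.trans (hB T)

theorem lintegral_rpow_tsum_cube_le {n : ℕ} {μ : Measure (Fin n → ℝ)} {K : ℝ≥0∞} (hK0 : K ≠ 0)
    (hKt : K ≠ ∞) {E : ℕ → (Fin n → ℤ) → Set (Fin n → ℝ)} (hE : ∀ j m, MeasurableSet (E j m))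
    (hEQ : ∀ j m, E j m ⊆ cube j m) (hfin : ∀ j (m : Fin n → ℤ), μ (gridCube j m) ≠ ∞)
    (hK : ∀ j m, μ (gridCube j m) ≤ K * μ (E j m)) {s : ℝ} (hs : 0 < s)
    {a : ℕ × (Fin n → ℤ) → ℝ≥0∞} (ha : ∀ k, a k ≠ ∞) :
    ∫⁻ x, (∑' k : ℕ × (Fin n → ℤ), (cube k.1 k.2).indicator (fun _ => a k) x) ^ s ∂μ ≤
      (2 ^ n : ℝ≥0∞) ^ s * (2 ^ n * nestedConst K s) *
        ∫⁻ x, (∑' k : ℕ × (Fin n → ℤ), (E k.1 k.2).indicator (fun _ => a k) x) ^ s ∂μ := by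
  have hQ : ∀ k : ℕ × (Fin n → ℤ), MeasurableSet (cube k.1 k.2) :=
    fun k => measurableSet_cube _ _
  refine lintegral_rpow_le_of_tendsto
    (fun T => measurable_sum_indicator T hQ a) (fun x => ?_) s fun T => ?_
  · rw [ENNReal.tsum_eq_iSup_sum]
    exact tendsto_atTop_iSup fun _ _ hST => Finset.sum_le_sum_of_subset hST
  refine (lintegral_rpow_sum_cube_le hK0 hKt hE hEQ hfin hK hs ha T).trans ?_
  gcongr with x
  exact ENNReal.sum_le_tsum T

theorem lintegral_rpow_iSup_cube_le {n : ℕ} {μ : Measure (Fin n → ℝ)} {K : ℝ≥0∞} (hK0 : K ≠ 0)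
    (hKt : K ≠ ∞) {E : ℕ → (Fin n → ℤ) → Set (Fin n → ℝ)} (hE : ∀ j m, MeasurableSet (E j m))
    (hEQ : ∀ j m, E j m ⊆ cube j m) (hfin : ∀ j (m : Fin n → ℤ), μ (gridCube j m) ≠ ∞)
    (hK : ∀ j m, μ (gridCube j m) ≤ K * μ (E j m)) {p : ℝ} (hp : 0 < p)
    {a : ℕ × (Fin n → ℤ) → ℝ≥0∞} (ha : ∀ k, a k ≠ ∞) :
    ∫⁻ x, (⨆ k : ℕ × (Fin n → ℤ), (cube k.1 k.2).indicator (fun _ => a k) x) ^ p ∂μ ≤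
      2 ^ n * (2 ^ n * K) * 2 *
        ∫⁻ x, (⨆ k : ℕ × (Fin n → ℤ), (E k.1 k.2).indicator (fun _ => a k) x) ^ p ∂μ := by
  refine lintegral_rpow_le_of_tendsto (f := fun T x => T.sup fun k : ℕ × (Fin n → ℤ) =>
    (cube k.1 k.2).indicator (fun _ => a k) x) (fun T => ?_) (fun x => ?_) p
    (lintegral_rpow_sup_cube_le hK0 hKt hE hEQ hfin hK hp ha)
  · simp_rw [Finset.sup_eq_iSup]
    exact Measurable.iSup fun k => Measurable.iSup fun _ =>
      measurable_const.indicator (measurableSet_cube _ _)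
  · have hmono : Monotone fun T : Finset (ℕ × (Fin n → ℤ)) =>
        T.sup fun k => (cube k.1 k.2).indicator (fun _ => a k) x :=
      fun _ _ hST => Finset.sup_mono hST
    have h := tendsto_atTop_iSup hmono
    simp only [Finset.sup_eq_iSup] at h ⊢
    rwa [← iSup_eq_iSup_finset] at h

/-! ### The sequence space quasi-norms -/

theorem ellNorm_mono {n : ℕ} (q : ℝ≥0∞) {a b : ℕ → (Fin n → ℤ) → ℝ≥0∞}
    (h : ∀ j m, a j m ≤ b j m) : ellNorm q a ≤ ellNorm q b := by
  unfold ellNorm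
  split_ifs
  · exact iSup_mono fun j => iSup_mono fun m => h j m
  · gcongr
    exact h _ _

theorem seqNorm_mono {n : ℕ} [NeZero n] {p : ℝ} (hp : 0 < p) (q : ℝ≥0∞) (α : ℝ)
    {A B : ℕ → (Fin n → ℤ) → Set (Fin n → ℝ)} (h : ∀ j m, A j m ⊆ B j m)
    (lam : ℕ → (Fin n → ℤ) → ℂ) : seqNorm p q α A lam ≤ seqNorm p q α B lam := by
  unfold seqNorm
  gcongr with x
  refine ellNorm_mono q fun j m => ?_
  gcongr
  exact h j m

theorem exists_lintegral_ellNorm_cube_le (n : ℕ) [NeZero n] {p : ℝ} (hp : 0 < p) {q : ℝ≥0∞}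
    (hq : 0 < q) {α : ℝ} (hα : -1 < α) {c : ℝ≥0} (hc : 0 < c) :
    ∃ C : ℝ≥0∞, C ≠ ∞ ∧ ∀ E : ℕ → (Fin n → ℤ) → Set (Fin n → ℝ),
      (∀ j m, MeasurableSet (E j m)) → (∀ j m, E j m ⊆ cube j m) →
      (∀ j m, volume (cube j m) ≤ c * volume (E j m)) →
      ∀ a : ℕ → (Fin n → ℤ) → ℝ≥0∞, (∀ j m, a j m ≠ ∞) →
        ∫⁻ x, ellNorm q (fun j m => (cube j m).indicator (fun _ => a j m) x) ^ p
          ∂(weightMeasure n α) ≤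
        C * ∫⁻ x, ellNorm q (fun j m => (E j m).indicator (fun _ => a j m) x) ^ p
          ∂(weightMeasure n α) := by
  -- The factor `4 ^ n` is the volume ratio between a grid cube and the dyadic cube inside it.
  obtain ⟨K, hK0, hKt, hK⟩ := exists_weightMeasure_box_le n hα (k := 4 ^ n * c) (by positivity)
  have hside : ∀ j : ℕ, 0 < 4 * (2 : ℝ)⁻¹ ^ j := fun j => by positivity
  have hfin : ∀ j (m : Fin n → ℤ), weightMeasure n α (gridCube j m) ≠ ∞ :=
    fun j m => (hK _ _ (hside j)).1
  have hKE : ∀ E : ℕ → (Fin n → ℤ) → Set (Fin n → ℝ), (∀ j m, E j m ⊆ cube j m) →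
      (∀ j m, volume (cube j m) ≤ c * volume (E j m)) → ∀ j m,
        weightMeasure n α (gridCube j m) ≤ K * weightMeasure n α (E j m) := by
    intro E hEQ hEc j m
    refine (hK _ _ (hside j)).2 _ ((hEQ j m).trans (cube_subset_gridCube j m)) ?_
    have h := volume_gridCube j m
    rw [gridCube] at h
    rw [h]
    push_cast
    rw [mul_assoc]
    gcongr
    exact hEc j m
  by_cases hqt : q = ∞
  · refine ⟨2 ^ n * (2 ^ n * K) * 2, by finiteness, fun E hE hEQ hEc a ha => ?_⟩
    have hell : ∀ b : ℕ → (Fin n → ℤ) → ℝ≥0∞,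
        ellNorm q b = ⨆ k : ℕ × (Fin n → ℤ), b k.1 k.2 := fun b => by
      rw [ellNorm, if_pos hqt, iSup_prod]
    simp only [hell]
    exact lintegral_rpow_iSup_cube_le (a := fun k => a k.1 k.2) hK0 hKt hE hEQ hfin
      (hKE E hEQ hEc) hp fun k => ha _ _
  · have hq0 : 0 < q.toReal := ENNReal.toReal_pos hq.ne' hqt
    set s := 1 / q.toReal * p with hs_def
    have hs : 0 < s := by positivity
    refine ⟨(2 ^ n : ℝ≥0∞) ^ s * (2 ^ n * nestedConst K s), ?_, fun E hE hEQ hEc a ha => ?_⟩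
    · have := nestedConst_ne_top hKt s
      finiteness
    have hell : ∀ (A : ℕ → (Fin n → ℤ) → Set (Fin n → ℝ)) x,
        ellNorm q (fun j m => (A j m).indicator (fun _ => a j m) x) ^ p =
          (∑' k : ℕ × (Fin n → ℤ),
            (A k.1 k.2).indicator (fun _ => a k.1 k.2 ^ q.toReal) x) ^ s := by
      intro A x
      rw [ellNorm, if_neg hqt, ← ENNReal.rpow_mul, ENNReal.tsum_prod
        (f := fun j m => (A j m).indicator (fun _ => a j m ^ q.toReal) x)]
      congr 1
      refine tsum_congr fun j => tsum_congr fun m => ?_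
      by_cases hx : x ∈ A j m <;> simp [hx, hq0]
    simp only [hell]
    exact lintegral_rpow_tsum_cube_le (a := fun k => a k.1 k.2 ^ q.toReal) hK0 hKt hE hEQ hfin
      (hKE E hEQ hEc) hs fun k => ENNReal.rpow_ne_top_of_nonneg hq0.le (ha _ _)

end WeightedTL

/-- The constant `C` depends only on `n, p, q, α` and the constant `c` in `|Q_{j,m}| ≤ c |E_{j,m}|`;
the other half of `|E_{j,m}| ∼ |Q_{j,m}|` is contained in `E_{j,m} ⊆ Q_{j,m}`. -/
theorem mainTheorem6 (n : ℕ) [NeZero n] (p : ℝ) (hp : 0 < p) (q : ℝ≥0∞) (hq : 0 < q)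
    (α : ℝ) (hα : -1 < α) (c : ℝ≥0) (hc : 0 < c) :
    ∃ C : ℝ≥0, 0 < C ∧
      ∀ E : ℕ → (Fin n → ℤ) → Set (Fin n → ℝ),
        (∀ j m, NullMeasurableSet (E j m) volume) →
        (∀ j m, E j m ⊆ WeightedTL.cube j m) →
        (∀ j m, volume (WeightedTL.cube j m) ≤ (c : ℝ≥0∞) * volume (E j m)) →
        ∀ lam : ℕ → (Fin n → ℤ) → ℂ,
          WeightedTL.fNorm p q α lam ≤ (C : ℝ≥0∞) * WeightedTL.seqNorm p q α E lam ∧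
          WeightedTL.seqNorm p q α E lam ≤ (C : ℝ≥0∞) * WeightedTL.fNorm p q α lam := by
  obtain ⟨B, hB, h⟩ := WeightedTL.exists_lintegral_ellNorm_cube_le n hp hq hα hc
  have hBp : B ^ (1 / p) ≠ ∞ := ENNReal.rpow_ne_top_of_nonneg (by positivity) hB
  refine ⟨max 1 (B ^ (1 / p)).toNNReal, lt_max_of_lt_left one_pos,
    fun E hE hEQ hEc lam => ⟨?_, ?_⟩⟩
  -- Null measurable sets are replaced by measurable subsets of equal volume. Shrinking only lowers
  -- the right-hand side, so the bound for `E'` implies the one for `E`.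
  · choose E' hE'E hE'm hE'ae using fun j m => (hE j m).exists_measurable_subset_ae_eq
    have hmain := h E' hE'm (fun j m => (hE'E j m).trans (hEQ j m))
      (fun j m => by rw [measure_congr (hE'ae j m)]; exact hEc j m)
      (fun j m => ‖lam j m‖ₑ * (2 : ℝ≥0∞) ^ ((j : ℝ) * (n : ℝ) / p))
      (fun j m => ENNReal.mul_ne_top enorm_ne_top
        (ENNReal.rpow_ne_top_of_nonneg (by positivity) (by simp)))
    calc WeightedTL.fNorm p q α lam ≤ B ^ (1 / p) * WeightedTL.seqNorm p q α E' lam := by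
          unfold WeightedTL.fNorm WeightedTL.seqNorm
          rw [← ENNReal.mul_rpow_of_nonneg _ _ (by positivity)]
          gcongr
      _ ≤ _ := by
          gcongr
          · rw [ENNReal.coe_max, ENNReal.coe_toNNReal hBp]
            exact le_max_right _ _
          · exact WeightedTL.seqNorm_mono hp q α hE'E lam
  · calc WeightedTL.seqNorm p q α E lam ≤ 1 * WeightedTL.fNorm p q α lam := by
          rw [one_mul]
          exact WeightedTL.seqNorm_mono hp q α hEQ lam
      _ ≤ _ := by
          gcongr
          rw [ENNReal.coe_max]
          exact le_max_left _ _
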